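/- Let $k, d$ be non-negative integers with $d+k>0$. Let $P_k=\mathbb F_2[x_1,\dots,x_k]$, graded with each $x_j$ of degree $1$, be regarded as a module over the mod-2 Steenrod algebra $\mathcal A$ in the usual way ($Sq^0(x_j)=x_j$, $Sq^1(x_j)=x_j^2$, $Sq^i(x_j)=0$ for $i>1$, together with the Cartan formula), and let $GL_k=GL_k(\mathbb F_2)$ act on $P_k$ by linear substitutions of the variables, and hence on $\mathbb F_2\otimes_{\mathcal A}P_k=P_k/\mathcal A^+P_k$. Here $\mathcal A^+$ is the augmentation ideal of $\mathcal A$. Write $(\mathbb F_2\otimes_{\mathcal A}P_k)_n$ for the subspace of classes represented by homogeneous polynomials of degree $n$. Kameko's squaring operation $$\widetilde{Sq}^0_*:(\mathbb F_2\otimes_{\mathcal A}P_k)_{2n+k}\longrightarrow(\mathbb F_2\otimes_{\mathcal A}P_k)_n$$ is the linear map induced by the $\mathbb F_2$-linear map $\phi:P_k\to P_k$ with $\phi(x_1x_2\cdots x_k\,y^2)=y$ for every monomial $y$, and $\phi(x)=0$ for every monomial $x$ that is not of this form. For a positive integer $n$ let $\alpha(n)$ be the number of ones in the binary expansion of $n$,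 let $\zeta(n)$ be the greatest integer $u$ such that $2^u$ divides $n$, and set $$t(k,d)=\max\{0,\;k-\alpha(d+k)-\zeta(d+k)\}.$$ Then, for every integer $t\ge 0$, the following are equivalent: (1) for every integer $s\ge t$, the iterated operation $$(\widetilde{Sq}^0_*)^{s-t}:(\mathbb F_2\otimes_{\mathcal A}P_k)_{k(2^s-1)+2^sd}\longrightarrow(\mathbb F_2\otimes_{\mathcal A}P_k)_{k(2^t-1)+2^td}$$ is an isomorphism of $GL_k$-modules; (2) $t\ge t(k,d)$. -/

import Mathlib

noncomputable section

namespace HitProblem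

/-- The polynomial algebra `P_k = 𝔽₂[x_1, …, x_k]`. -/
abbrev P (k : ℕ) : Type := MvPolynomial (Fin k) (ZMod 2)

/-! ### Steenrod squares on polynomials -/

/-- The total Steenrod square `f ↦ ∑ i, Sq^i(f) T^i`: the algebra homomorphism
`P_k → P_k[T]` (Cartan formula) with `x_j ↦ x_j + x_j ^ 2 T`. -/
def totalSq (k : ℕ) : P k →ₐ[ZMod 2] Polynomial (P k) :=
  MvPolynomial.aeval fun j : Fin k =>
    Polynomial.C (MvPolynomial.X j) + Polynomial.C (MvPolynomial.X j ^ 2) * Polynomial.X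

/-- The Steenrod square `Sq^i : P_k → P_k`. -/
def sq (k i : ℕ) : Module.End (ZMod 2) (P k) :=
  ((Polynomial.lcoeff (P k) i).restrictScalars (ZMod 2)).comp (totalSq k).toLinearMap

theorem sq_apply (k i : ℕ) (f : P k) : sq k i f = (totalSq k f).coeff i := rfl

/-! ### The mod 2 Steenrod algebra -/

/-- The defining relations of the mod 2 Steenrod algebra on the generators `Sq^i`, `i ≥ 0`:
`Sq^0 = 1` and the Adem relations. -/
inductive SteenrodRel : FreeAlgebra (ZMod 2) ℕ → FreeAlgebra (ZMod 2) ℕ → Prop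
  | sq_zero : SteenrodRel (FreeAlgebra.ι (ZMod 2) 0) 1
  | adem (a b : ℕ) (ha : 0 < a) (hab : a < 2 * b) :
      SteenrodRel (FreeAlgebra.ι (ZMod 2) a * FreeAlgebra.ι (ZMod 2) b)
        (∑ j ∈ Finset.range (a / 2 + 1), ((b - 1 - j).choose (a - 2 * j) : ZMod 2) •
          (FreeAlgebra.ι (ZMod 2) (a + b - j) * FreeAlgebra.ι (ZMod 2) j))

/-- The mod 2 Steenrod algebra `𝒜`. -/
abbrev SteenrodAlgebra : Type := RingQuot SteenrodRel

theorem steenrodRel_augmentation ⦃x y : FreeAlgebra (ZMod 2) ℕ⦄ (h : SteenrodRel x y) :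
    FreeAlgebra.lift (ZMod 2) (fun i : ℕ => if i = 0 then (1 : ZMod 2) else 0) x =
      FreeAlgebra.lift (ZMod 2) (fun i : ℕ => if i = 0 then (1 : ZMod 2) else 0) y := by
  cases h with
  | sq_zero => simp
  | adem a b ha hab =>
    simp only [map_mul, FreeAlgebra.lift_ι_apply, map_sum, map_smul]
    rw [if_neg (by omega : a ≠ 0), zero_mul]
    symm
    refine Finset.sum_eq_zero fun j hj => ?_
    rw [Finset.mem_range] at hj
    rw [if_neg (by omega : a + b - j ≠ 0), zero_mul, smul_zero]

/-- The augmentation `ε : 𝒜 → 𝔽₂`, with `ε(Sq^0) = 1` and `ε(Sq^i) = 0` for `i > 0`. -/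
def augmentation : SteenrodAlgebra →ₐ[ZMod 2] ZMod 2 :=
  RingQuot.liftAlgHom (ZMod 2)
    ⟨FreeAlgebra.lift (ZMod 2) (fun i : ℕ => if i = 0 then (1 : ZMod 2) else 0),
      steenrodRel_augmentation⟩

/-! ### The Adem relations hold on polynomials -/

theorem totalSq_X (k : ℕ) (j : Fin k) : totalSq k (MvPolynomial.X j) =
    Polynomial.C (MvPolynomial.X j) + Polynomial.C (MvPolynomial.X j ^ 2) * Polynomial.X := by
  simp [totalSq]

theorem totalSq_C (k : ℕ) (c : ZMod 2) :
    totalSq k (MvPolynomial.C c) = Polynomial.C (MvPolynomial.C c) := by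
  rw [← MvPolynomial.algebraMap_eq, AlgHom.commutes]
  rfl

/-- The squares with an integer index, zero for negative index. -/
def sqZ (k : ℕ) (n : ℤ) : Module.End (ZMod 2) (P k) := if n < 0 then 0 else sq k n.toNat

theorem sqZ_neg (k : ℕ) {n : ℤ} (h : n < 0) : sqZ k n = 0 := if_pos h

theorem sqZ_natCast (k n : ℕ) : sqZ k n = sq k n := by
  simp [sqZ]

theorem sqZ_X_mul (k : ℕ) (n : ℤ) (i : Fin k) (f : P k) :
    sqZ k n (MvPolynomial.X i * f) =
      MvPolynomial.X i * sqZ k n f + MvPolynomial.X i ^ 2 * sqZ k (n - 1) f := by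
  rcases lt_or_ge n 0 with h | h
  · simp [sqZ_neg k h, sqZ_neg k (show n - 1 < 0 by omega)]
  · obtain ⟨m, rfl⟩ := Int.eq_ofNat_of_zero_le h
    cases m with
    | zero =>
      rw [sqZ_natCast, sqZ_neg k (show ((0 : ℕ) : ℤ) - 1 < 0 by norm_num)]
      simp only [sq_apply, map_mul, totalSq_X, add_mul, mul_assoc, Polynomial.coeff_add,
        Polynomial.coeff_C_mul, Polynomial.coeff_X_mul_zero, LinearMap.zero_apply]
    | succ m =>
      rw [show ((m + 1 : ℕ) : ℤ) - 1 = (m : ℕ) by push_cast; ring, sqZ_natCast, sqZ_natCast]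
      simp only [sq_apply, map_mul, totalSq_X, add_mul, mul_assoc, Polynomial.coeff_add,
        Polynomial.coeff_C_mul, Polynomial.coeff_X_mul]

theorem sqZ_X_sq_mul (k : ℕ) (n : ℤ) (i : Fin k) (f : P k) :
    sqZ k n (MvPolynomial.X i ^ 2 * f) =
      MvPolynomial.X i ^ 2 * sqZ k n f + MvPolynomial.X i ^ 4 * sqZ k (n - 2) f := by
  have h2 : (2 : P k) = 0 := CharTwo.two_eq_zero
  rw [pow_two, mul_assoc, sqZ_X_mul, sqZ_X_mul, sqZ_X_mul, show n - 1 - 1 = n - 2 by ring]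
  linear_combination (MvPolynomial.X i ^ 3 * sqZ k (n - 1) f) * h2

theorem sqZ_C (k : ℕ) (n : ℤ) (c : ZMod 2) :
    sqZ k n (MvPolynomial.C c) = if n = 0 then MvPolynomial.C c else 0 := by
  rcases lt_or_ge n 0 with h | h
  · simp [sqZ_neg k h, h.ne]
  · obtain ⟨m, rfl⟩ := Int.eq_ofNat_of_zero_le h
    rw [sqZ_natCast, sq_apply, totalSq_C, Polynomial.coeff_C]
    simp

/-- The mod 2 binomial coefficient `(b-1-j choose a-2j)`, for integers. -/
def ademCoeff (a b j : ℤ) : ZMod 2 :=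
  if a - 2 * j < 0 then 0 else ((Ring.choose (b - 1 - j) (a - 2 * j).toNat : ℤ) : ZMod 2)

theorem ademCoeff_of_neg {a b j : ℤ} (h : a - 2 * j < 0) : ademCoeff a b j = 0 := if_pos h

theorem ademCoeff_pascal (a b j : ℤ) :
    ademCoeff a b j + ademCoeff a b (j + 1) =
      ademCoeff (a - 1) b j + ademCoeff a (b - 1) j := by
  unfold ademCoeff
  obtain ⟨v, hv⟩ : ∃ v, b - 1 - j = v + 1 := ⟨b - 1 - j - 1, by ring⟩
  rw [show b - 1 - (j + 1) = v by omega, show b - 1 - 1 - j = v by omega, hv]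
  rcases lt_or_ge (a - 2 * j) 0 with h | h
  · rw [if_pos h, if_pos (by omega), if_pos (by omega), if_pos h]
  · obtain ⟨u, hu⟩ := Int.eq_ofNat_of_zero_le h
    rw [show a - 2 * (j + 1) = (u : ℤ) - 2 by omega, show a - 1 - 2 * j = (u : ℤ) - 1 by omega, hu]
    match u with
    | 0 => simp
    | 1 => simp [add_comm]
    | u + 2 =>
      have e1 : (((u + 2 : ℕ) : ℤ) - 2).toNat = u := by omega
      have e2 : (((u + 2 : ℕ) : ℤ) - 1).toNat = u + 1 := by omega
      have e3 : (((u + 2 : ℕ) : ℤ)).toNat = u + 2 := by omega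
      rw [if_neg (by omega), if_neg (by omega), if_neg (by omega), if_neg (by omega), e1, e2, e3,
        Ring.choose_succ_succ v (u + 1), Ring.choose_succ_succ v u]
      push_cast
      have h2 : (2 : ZMod 2) = 0 := rfl
      linear_combination 0 * h2

theorem adem_top (k : ℕ) (a b : ℤ) (h1 : 2 * b ≤ a) (h2 : a ≤ 2 * b + 1) (N : ℕ) (hN : a < 2 * N)
    (f : P k) : sqZ k a (sqZ k b f) =
      ∑ j ∈ Finset.range N, ademCoeff a b j • sqZ k (a + b - j) (sqZ k j f) := by
  rcases lt_or_ge b 0 with hb | hb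
  · rw [sqZ_neg k hb]
    simp only [LinearMap.zero_apply, map_zero]
    symm
    refine Finset.sum_eq_zero fun j _ => ?_
    rw [ademCoeff_of_neg (by omega), zero_smul]
  · obtain ⟨m, rfl⟩ := Int.eq_ofNat_of_zero_le hb
    rw [Finset.sum_eq_single_of_mem m (by rw [Finset.mem_range]; omega)]
    · rw [show a + (m : ℤ) - m = a by ring]
      have : ademCoeff a m m = 1 := by
        unfold ademCoeff
        rw [if_neg (by omega), show (m : ℤ) - 1 - m = -1 by ring]
        rcases (show a - 2 * m = 0 ∨ a - 2 * m = 1 by omega) with h | h <;> rw [h] <;> simp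
      rw [this, one_smul]
    · intro j _ hj
      have : ademCoeff a m j = 0 := by
        rcases lt_or_gt_of_ne hj with h | h
        · unfold ademCoeff
          rw [if_neg (by omega), show (m : ℤ) - 1 - j = ((m - 1 - j : ℕ) : ℤ) by omega,
            Ring.choose_natCast, Nat.choose_eq_zero_of_lt (by omega)]
          simp
        · exact ademCoeff_of_neg (by omega)
      rw [this, zero_smul]

theorem adem_general (k : ℕ) (f : P k) : ∀ (a b : ℤ), a ≤ 2 * b + 1 → ∀ N : ℕ, a < 2 * N →
    sqZ k a (sqZ k b f) =
      ∑ j ∈ Finset.range N, ademCoeff a b j • sqZ k (a + b - j) (sqZ k j f) := by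
  induction f using MvPolynomial.induction_on with
  | C c =>
    intro a b hab N hN
    rcases le_or_gt (2 * b) a with h | h
    · exact adem_top k a b h hab N hN _
    simp only [sqZ_C]
    have hR : ∀ j ∈ Finset.range N, ademCoeff a b j •
        sqZ k (a + b - j) (if (j : ℤ) = 0 then MvPolynomial.C c else 0) = 0 := by
      intro j _
      split_ifs with hj
      · rcases lt_or_ge a 0 with ha | ha
        · rw [ademCoeff_of_neg (by omega), zero_smul]
        · rw [sqZ_C, if_neg (by omega), smul_zero]
      · simp
    rw [Finset.sum_eq_zero hR]
    split_ifs with hb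
    · rw [sqZ_neg k (by omega)]; rfl
    · simp
  | add p q hp hq =>
    intro a b hab N hN
    simp only [map_add, smul_add, Finset.sum_add_distrib]
    rw [hp a b hab N hN, hq a b hab N hN]
  | mul_X p i ih =>
    intro a b hab N hN
    rcases le_or_gt (2 * b) a with h | h
    · exact adem_top k a b h hab N hN _
    rw [mul_comm p]
    simp only [sqZ_X_mul, sqZ_X_sq_mul, map_add, smul_add, Finset.sum_add_distrib]
    have ih1 := ih a b hab N hN
    have ih2 := ih (a - 1) b (by omega) N (by omega)
    have ih3 := ih a (b - 1) (by omega) N (by omega)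
    have hF0 : ∀ x : ℤ, sqZ k x (sqZ k (((0 : ℕ) : ℤ) - 1) p) = 0 := by
      intro x
      rw [sqZ_neg k (show ((0 : ℕ) : ℤ) - 1 < 0 by norm_num), LinearMap.zero_apply, map_zero]
    have ih4 : sqZ k (a - 2) (sqZ k (b - 1) p) = ∑ j ∈ Finset.range N,
        ademCoeff a b j • sqZ k (a + b - j - 2) (sqZ k (j - 1) p) := by
      cases N with
      | zero => rw [sqZ_neg k (by omega)]; simp
      | succ M =>
        rw [ih (a - 2) (b - 1) (by omega) M (by omega), Finset.sum_range_succ', hF0, smul_zero,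
          add_zero]
        refine Finset.sum_congr rfl fun j _ => ?_
        push_cast
        rw [show a - 2 + (b - 1) - (j : ℤ) = a + b - (j + 1) - 2 by ring,
          show (j : ℤ) + 1 - 1 = j by ring]
        unfold ademCoeff
        rw [show a - 2 - 2 * (j : ℤ) = a - 2 * (j + 1) by ring,
          show b - 1 - 1 - (j : ℤ) = b - 1 - (j + 1) by ring]
    have hshift : ∑ j ∈ Finset.range N, ademCoeff a b j • sqZ k (a + b - j) (sqZ k (j - 1) p) =
        ∑ j ∈ Finset.range N, ademCoeff a b (j + 1) • sqZ k (a + b - j - 1) (sqZ k j p) := by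
      have e1 := Finset.sum_range_succ
        (fun j : ℕ => ademCoeff a b j • sqZ k (a + b - j) (sqZ k (j - 1) p)) N
      have e2 := Finset.sum_range_succ'
        (fun j : ℕ => ademCoeff a b j • sqZ k (a + b - j) (sqZ k (j - 1) p)) N
      rw [ademCoeff_of_neg (show a - 2 * (N : ℤ) < 0 by omega), zero_smul, add_zero] at e1
      rw [hF0, smul_zero, add_zero] at e2
      rw [← e1, e2]
      refine Finset.sum_congr rfl fun j _ => ?_
      push_cast
      rw [show a + b - ((j : ℤ) + 1) = a + b - j - 1 by ring, show (j : ℤ) + 1 - 1 = j by ring]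
    have hcross : sqZ k (a - 1) (sqZ k b p) + sqZ k a (sqZ k (b - 1) p) =
        ∑ j ∈ Finset.range N, ademCoeff a b j • sqZ k (a + b - j - 1) (sqZ k j p) +
          ∑ j ∈ Finset.range N, ademCoeff a b j • sqZ k (a + b - j) (sqZ k (j - 1) p) := by
      rw [hshift, ih2, ih3, ← Finset.sum_add_distrib, ← Finset.sum_add_distrib]
      refine Finset.sum_congr rfl fun j _ => ?_
      rw [show a - 1 + b - (j : ℤ) = a + b - j - 1 by ring,
        show a + (b - 1) - (j : ℤ) = a + b - j - 1 by ring, ← add_smul, ← add_smul,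
        ademCoeff_pascal]
    simp only [← mul_smul_comm, ← Finset.mul_sum]
    linear_combination MvPolynomial.X i * ih1 + MvPolynomial.X i ^ 2 * hcross +
      MvPolynomial.X i ^ 4 * ih4

theorem sq_zero_eq (k : ℕ) : sq k 0 = 1 := by
  apply LinearMap.ext
  intro f
  rw [← Int.toNat_zero, ← sqZ_natCast]
  induction f using MvPolynomial.induction_on with
  | C c => simp [sqZ_C]
  | add p q hp hq => rw [map_add, hp, hq, map_add]
  | mul_X p i ih =>
    rw [mul_comm p, sqZ_X_mul, ih, sqZ_neg k (show (((0 : ℤ).toNat : ℕ) : ℤ) - 1 < 0 by norm_num)]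
    simp

theorem steenrodRel_sq (k : ℕ) ⦃x y : FreeAlgebra (ZMod 2) ℕ⦄ (h : SteenrodRel x y) :
    FreeAlgebra.lift (ZMod 2) (sq k) x = FreeAlgebra.lift (ZMod 2) (sq k) y := by
  cases h with
  | sq_zero => rw [FreeAlgebra.lift_ι_apply, sq_zero_eq, map_one]
  | adem a b ha hab =>
    simp only [map_mul, FreeAlgebra.lift_ι_apply, map_sum, map_smul]
    apply LinearMap.ext
    intro f
    have h := adem_general k f a b (by omega) (a / 2 + 1) (by omega)
    simp only [sqZ_natCast] at h
    rw [Module.End.mul_apply, h, LinearMap.sum_apply]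
    refine Finset.sum_congr rfl fun j hj => ?_
    rw [Finset.mem_range] at hj
    have hc : ademCoeff a b j = ((b - 1 - j).choose (a - 2 * j) : ZMod 2) := by
      unfold ademCoeff
      rw [if_neg (by omega), show (b : ℤ) - 1 - j = ((b - 1 - j : ℕ) : ℤ) by omega,
        show ((a : ℤ) - 2 * j).toNat = a - 2 * j by omega, Ring.choose_natCast]
      simp
    rw [hc, show (a : ℤ) + b - j = ((a + b - j : ℕ) : ℤ) by omega, sqZ_natCast]
    rfl

/-- The action of the Steenrod algebra `𝒜` on `P_k`. -/
def steenrodAction (k : ℕ) : SteenrodAlgebra →ₐ[ZMod 2] Module.End (ZMod 2) (P k) :=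
  RingQuot.liftAlgHom (ZMod 2) ⟨FreeAlgebra.lift (ZMod 2) (sq k), steenrodRel_sq k⟩

/-! ### The space `𝔽₂ ⊗_𝒜 P_k = P_k / 𝒜⁺ P_k` -/

/-- The subspace `𝒜⁺ P_k` of hit polynomials, where `𝒜⁺ = ker ε` is the augmentation ideal. -/
def hit (k : ℕ) : Submodule (ZMod 2) (P k) :=
  Submodule.span (ZMod 2)
    {f | ∃ (θ : SteenrodAlgebra) (g : P k), augmentation θ = 0 ∧ f = steenrodAction k θ g}

theorem sq_mem_hit (k : ℕ) {i : ℕ} (hi : 0 < i) (g : P k) : sq k i g ∈ hit k := by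
  refine Submodule.subset_span
    ⟨RingQuot.mkAlgHom (ZMod 2) SteenrodRel (FreeAlgebra.ι (ZMod 2) i), g, ?_, ?_⟩
  · rw [augmentation, RingQuot.liftAlgHom_mkAlgHom_apply, FreeAlgebra.lift_ι_apply,
      if_neg hi.ne']
  · rw [steenrodAction, RingQuot.liftAlgHom_mkAlgHom_apply, FreeAlgebra.lift_ι_apply]

/-- A subspace containing all `Sq^i(g)` with `i > 0` contains all hit polynomials. -/
theorem hit_le (k : ℕ) (W : Submodule (ZMod 2) (P k))
    (hW : ∀ i : ℕ, 0 < i → ∀ g : P k, sq k i g ∈ W) : hit k ≤ W := by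
  have key : ∀ (x : FreeAlgebra (ZMod 2) ℕ) (g : P k),
      FreeAlgebra.lift (ZMod 2) (sq k) x g -
        FreeAlgebra.lift (ZMod 2) (fun i : ℕ => if i = 0 then (1 : ZMod 2) else 0) x • g ∈ W := by
    intro x
    induction x using FreeAlgebra.induction with
    | grade0 r =>
      intro g
      rw [AlgHom.commutes, AlgHom.commutes, Module.algebraMap_end_apply, Algebra.algebraMap_self,
        RingHom.id_apply, sub_self]
      exact W.zero_mem
    | grade1 i =>
      intro g
      rw [FreeAlgebra.lift_ι_apply, FreeAlgebra.lift_ι_apply]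
      split_ifs with hi
      · rw [hi, sq_zero_eq, one_smul, Module.End.one_apply, sub_self]
        exact W.zero_mem
      · rw [zero_smul, sub_zero]
        exact hW i (Nat.pos_of_ne_zero hi) g
    | mul x y hx hy =>
      intro g
      have h := W.add_mem (hx (FreeAlgebra.lift (ZMod 2) (sq k) y g))
        (W.smul_mem (FreeAlgebra.lift (ZMod 2)
          (fun i : ℕ => if i = 0 then (1 : ZMod 2) else 0) x) (hy g))
      rw [smul_sub, smul_smul, sub_add_sub_cancel] at h
      rwa [map_mul, map_mul, Module.End.mul_apply]
    | add x y hx hy =>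
      intro g
      have h := W.add_mem (hx g) (hy g)
      rwa [map_add, map_add, LinearMap.add_apply, add_smul, add_sub_add_comm]
  refine Submodule.span_le.2 ?_
  rintro f ⟨θ, g, hθ, rfl⟩
  obtain ⟨x, rfl⟩ := RingQuot.mkAlgHom_surjective (ZMod 2) SteenrodRel θ
  have h := key x g
  rw [augmentation, RingQuot.liftAlgHom_mkAlgHom_apply] at hθ
  rw [hθ, zero_smul, sub_zero] at h
  rw [steenrodAction, RingQuot.liftAlgHom_mkAlgHom_apply]
  exact h

/-- The space `𝔽₂ ⊗_𝒜 P_k = P_k / 𝒜⁺ P_k`. -/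
abbrev Q (k : ℕ) : Type := P k ⧸ hit k

/-- The subspace `(𝔽₂ ⊗_𝒜 P_k)_n` of the classes represented by homogeneous polynomials of
degree `n`. -/
def QDeg (k n : ℕ) : Submodule (ZMod 2) (Q k) :=
  (MvPolynomial.homogeneousSubmodule (Fin k) (ZMod 2) n).map (hit k).mkQ

/-! ### The action of `GL_k` -/

/-- The algebra homomorphism `P_k → P_k` with `x_j ↦ ∑ i, M i j x_i`. -/
def linSubst (k : ℕ) (M : Matrix (Fin k) (Fin k) (ZMod 2)) : P k →ₐ[ZMod 2] P k :=
  MvPolynomial.aeval fun j : Fin k => ∑ i : Fin k, MvPolynomial.C (M i j) * MvPolynomial.X i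

theorem linSubst_X (k : ℕ) (M : Matrix (Fin k) (Fin k) (ZMod 2)) (j : Fin k) :
    linSubst k M (MvPolynomial.X j) =
      ∑ i : Fin k, MvPolynomial.C (M i j) * MvPolynomial.X i := by
  simp [linSubst]

theorem linSubst_C (k : ℕ) (M : Matrix (Fin k) (Fin k) (ZMod 2)) (c : ZMod 2) :
    linSubst k M (MvPolynomial.C c) = MvPolynomial.C c := by
  simp [linSubst]

theorem linSubst_one (k : ℕ) : linSubst k 1 = AlgHom.id (ZMod 2) (P k) := by
  apply MvPolynomial.algHom_ext
  intro j
  rw [linSubst_X, Finset.sum_eq_single j]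
  · simp
  · intro i _ hij
    simp [Matrix.one_apply_ne hij]
  · simp

theorem linSubst_mul (k : ℕ) (M N : Matrix (Fin k) (Fin k) (ZMod 2)) :
    linSubst k (M * N) = (linSubst k M).comp (linSubst k N) := by
  apply MvPolynomial.algHom_ext
  intro j
  rw [AlgHom.comp_apply, linSubst_X, linSubst_X, map_sum]
  simp only [map_mul, linSubst_C, linSubst_X, Matrix.mul_apply, map_sum, Finset.sum_mul,
    Finset.mul_sum]
  rw [Finset.sum_comm]
  refine Finset.sum_congr rfl fun l _ => Finset.sum_congr rfl fun i _ => ?_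
  ring

/-- The action of `GL_k` on `P_k` by linear substitutions of the variables. -/
def glP (k : ℕ) : Representation (ZMod 2) (GL (Fin k) (ZMod 2)) (P k) where
  toFun g := (linSubst k g.1).toLinearMap
  map_one' := by
    rw [Units.val_one, linSubst_one]
    rfl
  map_mul' g h := by
    rw [Units.val_mul, linSubst_mul]
    rfl

theorem totalSq_linSubst (k : ℕ) (M : Matrix (Fin k) (Fin k) (ZMod 2)) (f : P k) :
    totalSq k (linSubst k M f) = (totalSq k f).map (linSubst k M).toRingHom := by
  have hsq : ∀ c : ZMod 2, c ^ 2 = c := by decide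
  have h : (totalSq k).comp (linSubst k M) =
      (Polynomial.mapAlgHom (linSubst k M)).comp (totalSq k) := by
    apply MvPolynomial.algHom_ext
    intro j
    rw [AlgHom.comp_apply, AlgHom.comp_apply, linSubst_X, totalSq_X, map_sum]
    have hp : (∑ i : Fin k, MvPolynomial.C (M i j) * MvPolynomial.X i : P k) ^ 2 =
        ∑ i : Fin k, MvPolynomial.C (M i j) * MvPolynomial.X i ^ 2 := by
      rw [sum_pow_char 2]
      refine Finset.sum_congr rfl fun i _ => ?_
      rw [mul_pow, ← MvPolynomial.C_pow, hsq]
    rw [Polynomial.coe_mapAlgHom, Polynomial.map_add, Polynomial.map_mul, Polynomial.map_C,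
      Polynomial.map_C, Polynomial.map_X]
    change _ = Polynomial.C (linSubst k M (MvPolynomial.X j)) +
      Polynomial.C (linSubst k M (MvPolynomial.X j ^ 2)) * Polynomial.X
    rw [map_pow, linSubst_X, hp, map_sum, map_sum, Finset.sum_mul, ← Finset.sum_add_distrib]
    refine Finset.sum_congr rfl fun i _ => ?_
    rw [map_mul, totalSq_C, totalSq_X, Polynomial.C_mul, Polynomial.C_mul, mul_add, mul_assoc]
  exact DFunLike.congr_fun h f

theorem sq_linSubst (k i : ℕ) (M : Matrix (Fin k) (Fin k) (ZMod 2)) (f : P k) :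
    sq k i (linSubst k M f) = linSubst k M (sq k i f) := by
  rw [sq_apply, totalSq_linSubst, Polynomial.coeff_map]
  rfl

theorem hit_le_comap_glP (k : ℕ) (g : GL (Fin k) (ZMod 2)) : hit k ≤ (hit k).comap (glP k g) := by
  refine hit_le k _ fun i hi f => ?_
  rw [Submodule.mem_comap]
  change linSubst k g.1 (sq k i f) ∈ hit k
  rw [← sq_linSubst]
  exact sq_mem_hit k hi _

/-- The inherited action of `GL_k` on `𝔽₂ ⊗_𝒜 P_k`. -/
def glQ (k : ℕ) : Representation (ZMod 2) (GL (Fin k) (ZMod 2)) (Q k) :=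
  (glP k).quotient (hit k) (hit_le_comap_glP k)

theorem isHomogeneous_linSubst (k : ℕ) (M : Matrix (Fin k) (Fin k) (ZMod 2)) {n : ℕ} {f : P k}
    (hf : f.IsHomogeneous n) : (linSubst k M f).IsHomogeneous n := by
  have h := hf.aeval (fun j : Fin k => ∑ i : Fin k, MvPolynomial.C (M i j) * MvPolynomial.X i)
    (n := 1) (fun j => MvPolynomial.IsHomogeneous.sum _ _ _ fun i _ => by
      simpa using (MvPolynomial.isHomogeneous_C (Fin k) (M i j)).mul
        (MvPolynomial.isHomogeneous_X (ZMod 2) i))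
  rwa [one_mul] at h

theorem QDeg_le_comap_glQ (k n : ℕ) (g : GL (Fin k) (ZMod 2)) :
    QDeg k n ≤ (QDeg k n).comap (glQ k g) := by
  rintro _ ⟨f, hf, rfl⟩
  exact ⟨linSubst k g.1 f, isHomogeneous_linSubst k g.1 hf, rfl⟩

/-- The action of `GL_k` on `(𝔽₂ ⊗_𝒜 P_k)_n`. -/
def glQDeg (k n : ℕ) : Representation (ZMod 2) (GL (Fin k) (ZMod 2)) (QDeg k n) :=
  (glQ k).subrepresentation (QDeg k n) (QDeg_le_comap_glQ k n)

/-! ### Kameko's squaring operation -/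

/-- The linear map `φ : P_k → P_k` with `φ(x_1 x_2 ⋯ x_k y^2) = y` for a monomial `y`, and
`φ(x) = 0` for the other monomials `x`: a monomial with exponent vector `e` is of the first kind
if and only if all `e j` are odd, and then `y` has exponents `e j / 2`, rounded down. -/
def phi (k : ℕ) : P k →ₗ[ZMod 2] P k :=
  (MvPolynomial.basisMonomials (Fin k) (ZMod 2)).constr (ZMod 2) fun e : Fin k →₀ ℕ =>
    if ∀ j : Fin k, Odd (e j) then
      MvPolynomial.monomial (e.mapRange (fun m : ℕ => m / 2) (Nat.zero_div 2)) (1 : ZMod 2)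
    else 0

theorem phi_monomial (k : ℕ) (e : Fin k →₀ ℕ) :
    phi k (MvPolynomial.monomial e 1) = if ∀ j : Fin k, Odd (e j) then
      MvPolynomial.monomial (e.mapRange (fun m : ℕ => m / 2) (Nat.zero_div 2)) (1 : ZMod 2)
    else 0 := by
  have h := (MvPolynomial.basisMonomials (Fin k) (ZMod 2)).constr_basis (ZMod 2)
    (fun e : Fin k →₀ ℕ => if ∀ j : Fin k, Odd (e j) then
      MvPolynomial.monomial (e.mapRange (fun m : ℕ => m / 2) (Nat.zero_div 2)) (1 : ZMod 2)
    else 0) e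
  rwa [MvPolynomial.coe_basisMonomials] at h

theorem phi_mul_sq (k : ℕ) (h g : P k) : phi k (h * g ^ 2) = phi k h * g := by
  have hm : ∀ e f : Fin k →₀ ℕ,
      phi k (MvPolynomial.monomial e 1 * MvPolynomial.monomial f 1 ^ 2) =
        phi k (MvPolynomial.monomial e 1) * MvPolynomial.monomial f 1 := by
    intro e f
    rw [MvPolynomial.monomial_pow, MvPolynomial.monomial_mul, one_pow, one_mul, phi_monomial,
      phi_monomial]
    have hiff : (∀ j : Fin k, Odd ((e + 2 • f) j)) ↔ ∀ j : Fin k, Odd (e j) := by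
      refine forall_congr' fun j => ?_
      simp [Nat.odd_add]
    rw [if_congr hiff rfl rfl, ite_mul, zero_mul, MvPolynomial.monomial_mul, one_mul]
    refine if_congr Iff.rfl
      (congrArg (fun x => MvPolynomial.monomial x (1 : ZMod 2)) (Finsupp.ext fun j => ?_)) rfl
    simp only [Finsupp.mapRange_apply, Finsupp.add_apply, Finsupp.smul_apply, smul_eq_mul]
    omega
  have hsc : ∀ c : ZMod 2, c = 0 ∨ c = 1 := by decide
  induction g using MvPolynomial.induction_on' with
  | monomial f c =>
    rcases hsc c with rfl | rfl
    · simp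
    · induction h using MvPolynomial.induction_on' with
      | monomial e c =>
        rcases hsc c with rfl | rfl
        · simp
        · exact hm e f
      | add p q hp hq => rw [add_mul, map_add, map_add, add_mul, hp, hq]
  | add p q hp hq => rw [CharTwo.add_sq, mul_add, map_add, mul_add, hp, hq]

theorem phi_prod_X (k : ℕ) (S : Finset (Fin k)) :
    phi k (∏ j ∈ S, MvPolynomial.X j) = if S = Finset.univ then 1 else 0 := by
  have h : (∏ j ∈ S, MvPolynomial.X j : P k) =
      MvPolynomial.monomial (∑ j ∈ S, Finsupp.single j 1) 1 := by
    rw [MvPolynomial.monomial_sum_one]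
    rfl
  have he : ∀ i : Fin k, (∑ j ∈ S, Finsupp.single j 1 : Fin k →₀ ℕ) i = if i ∈ S then 1 else 0 := by
    intro i
    rw [Finsupp.finsetSum_apply]
    simp [Finsupp.single_apply]
  rw [h, phi_monomial]
  by_cases hS : S = Finset.univ
  · subst hS
    rw [if_pos (fun j => by rw [he]; simp), if_pos rfl]
    have : ((∑ j : Fin k, Finsupp.single j 1 : Fin k →₀ ℕ).mapRange (fun m : ℕ => m / 2)
        (Nat.zero_div 2)) = 0 := by
      ext i
      rw [Finsupp.mapRange_apply, he]
      simp
    rw [this]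
    rfl
  · rw [if_neg hS, if_neg]
    intro hodd
    apply hS
    rw [Finset.eq_univ_iff_forall]
    intro i
    by_contra hi
    have := hodd i
    rw [he, if_neg hi] at this
    exact absurd this (by decide)

theorem phi_sq_prod_X (k a : ℕ) (S : Finset (Fin k)) :
    phi k (sq k a (∏ j ∈ S, MvPolynomial.X j)) =
      if S = Finset.univ ∧ a = 0 then 1 else 0 := by
  have h1 : totalSq k (∏ j ∈ S, MvPolynomial.X j) = ∑ U ∈ S.powerset,
      Polynomial.C ((∏ j ∈ U, MvPolynomial.X j) * (∏ j ∈ S \ U, MvPolynomial.X j) ^ 2) *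
        Polynomial.X ^ (S \ U).card := by
    rw [map_prod, Finset.prod_congr rfl fun j _ => totalSq_X k j, Finset.prod_add]
    refine Finset.sum_congr rfl fun U _ => ?_
    rw [Finset.prod_mul_distrib, Finset.prod_const, ← map_prod, ← map_prod, Finset.prod_pow,
      ← mul_assoc, ← Polynomial.C_mul]
  rw [sq_apply, h1, Polynomial.finsetSum_coeff, map_sum]
  simp only [Polynomial.coeff_C_mul_X_pow]
  by_cases hS : S = Finset.univ
  · subst hS
    rw [Finset.sum_eq_single_of_mem Finset.univ (by simp)]
    · by_cases ha : a = 0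
      · simp [ha, phi_prod_X]
      · simp [ha]
    · intro U _ hU
      split_ifs
      · rw [phi_mul_sq, phi_prod_X, if_neg hU, zero_mul]
      · exact map_zero _
  · rw [if_neg (fun h => hS h.1)]
    refine Finset.sum_eq_zero fun U hU => ?_
    rw [Finset.mem_powerset] at hU
    split_ifs
    · rw [phi_mul_sq, phi_prod_X, if_neg, zero_mul]
      rintro rfl
      exact hS (Finset.univ_subset_iff.1 hU)
    · exact map_zero _

theorem coeff_sq_charTwo (k n : ℕ) (G : Polynomial (P k)) :
    (G ^ 2).coeff n = if 2 ∣ n then G.coeff (n / 2) ^ 2 else 0 := by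
  rw [← Polynomial.map_frobenius_expand, Polynomial.coeff_map, Polynomial.coeff_expand two_pos]
  split_ifs
  · rfl
  · exact map_zero _

theorem phi_sq (k n : ℕ) (f : P k) :
    phi k (sq k n f) = if 2 ∣ n then sq k (n / 2) (phi k f) else 0 := by
  have hm : ∀ (S : Finset (Fin k)) (g : P k),
      phi k (sq k n ((∏ j ∈ S, MvPolynomial.X j) * g ^ 2)) =
        if 2 ∣ n then sq k (n / 2) (phi k ((∏ j ∈ S, MvPolynomial.X j) * g ^ 2)) else 0 := by
    intro S g
    rw [phi_mul_sq, phi_prod_X, sq_apply, map_mul, map_pow, Polynomial.coeff_mul, map_sum]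
    have hterm : ∀ x : ℕ × ℕ, phi k ((totalSq k (∏ j ∈ S, MvPolynomial.X j)).coeff x.1 *
        (totalSq k g ^ 2).coeff x.2) =
        (if S = Finset.univ ∧ x.1 = 0 then 1 else 0) *
          (if 2 ∣ x.2 then sq k (x.2 / 2) g else 0) := by
      intro x
      rw [coeff_sq_charTwo]
      split_ifs with hx hS hS
      · rw [phi_mul_sq, ← sq_apply, phi_sq_prod_X, if_pos hS]
        rfl
      · rw [phi_mul_sq, ← sq_apply, phi_sq_prod_X, if_neg hS]
        rfl
      · simp
      · simp
    rw [Finset.sum_congr rfl fun x _ => hterm x,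
      Finset.sum_eq_single_of_mem (0, n) (by simp)]
    · by_cases hS : S = Finset.univ
      · simp [hS]
      · simp [hS]
    · rintro ⟨a, b⟩ hab hne
      rw [Finset.HasAntidiagonal.mem_antidiagonal] at hab
      rw [if_neg, zero_mul]
      rintro ⟨_, h0⟩
      apply hne
      simp only at h0 hab
      rw [Prod.mk.injEq]
      omega
  have hsc : ∀ c : ZMod 2, c = 0 ∨ c = 1 := by decide
  induction f using MvPolynomial.induction_on' with
  | monomial e c =>
    rcases hsc c with rfl | rfl
    · simp
    · have he : (MvPolynomial.monomial e 1 : P k) =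
          (∏ j ∈ Finset.univ.filter (fun j : Fin k => Odd (e j)), MvPolynomial.X j) *
            MvPolynomial.monomial (e.mapRange (fun m : ℕ => m / 2) (Nat.zero_div 2)) 1 ^ 2 := by
        have h : (∏ j ∈ Finset.univ.filter (fun j : Fin k => Odd (e j)), MvPolynomial.X j : P k) =
            MvPolynomial.monomial
              (∑ j ∈ Finset.univ.filter (fun j : Fin k => Odd (e j)), Finsupp.single j 1) 1 := by
          rw [MvPolynomial.monomial_sum_one]
          rfl
        rw [h, MvPolynomial.monomial_pow, MvPolynomial.monomial_mul, one_pow, one_mul]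
        refine congrArg (fun x => MvPolynomial.monomial x (1 : ZMod 2)) (Finsupp.ext fun i => ?_)
        rw [Finsupp.add_apply, Finsupp.finsetSum_apply, Finsupp.smul_apply,
          Finsupp.mapRange_apply]
        simp only [Finsupp.single_apply, Finset.sum_ite_eq', Finset.mem_filter, Finset.mem_univ,
          true_and, Nat.odd_iff, smul_eq_mul]
        split_ifs <;> omega
      rw [he]
      exact hm _ _
  | add p q hp hq =>
    rw [map_add, map_add, map_add, hp, hq]
    split_ifs
    · rw [map_add]
    · rw [add_zero]

theorem hit_le_comap_phi (k : ℕ) : hit k ≤ (hit k).comap (phi k) := by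
  refine hit_le k _ fun i hi f => ?_
  rw [Submodule.mem_comap, phi_sq]
  split_ifs with h
  · exact sq_mem_hit k (by omega) _
  · exact (hit k).zero_mem

/-- Kameko's squaring operation `S̃q^0_*` on `𝔽₂ ⊗_𝒜 P_k`, in all degrees at once, induced by
`φ`. -/
def kameko (k : ℕ) : Module.End (ZMod 2) (Q k) :=
  (hit k).mapQ (hit k) (phi k) (hit_le_comap_phi k)

theorem isHomogeneous_phi (k m : ℕ) {f : P k} (hf : f.IsHomogeneous (2 * m + k)) :
    (phi k f).IsHomogeneous m := by
  rw [f.as_sum, map_sum]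
  refine MvPolynomial.IsHomogeneous.sum _ _ _ fun e he => ?_
  have hdeg := hf (MvPolynomial.mem_support_iff.1 he)
  have hc : (MvPolynomial.monomial e (MvPolynomial.coeff e f) : P k) =
      MvPolynomial.coeff e f • MvPolynomial.monomial e 1 := by
    rw [MvPolynomial.smul_monomial, smul_eq_mul, mul_one]
  rw [hc, map_smul, phi_monomial]
  refine (MvPolynomial.homogeneousSubmodule (Fin k) (ZMod 2) m).smul_mem _ ?_
  rw [MvPolynomial.mem_homogeneousSubmodule]
  split_ifs with hodd
  · apply MvPolynomial.isHomogeneous_monomial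
    rw [Finsupp.weight_apply, Finsupp.sum_fintype _ _ (by simp)] at hdeg
    rw [Finsupp.degree_eq_sum]
    simp only [Finsupp.mapRange_apply, Pi.one_apply, smul_eq_mul, mul_one] at hdeg ⊢
    have h : ∑ j : Fin k, e j = ∑ j : Fin k, (2 * (e j / 2) + 1) :=
      Finset.sum_congr rfl fun j _ => by
        have := Nat.odd_iff.1 (hodd j)
        omega
    rw [h, Finset.sum_add_distrib, ← Finset.mul_sum] at hdeg
    simp only [Finset.sum_const, Finset.card_univ, Fintype.card_fin, smul_eq_mul, mul_one] at hdeg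
    omega
  · exact MvPolynomial.isHomogeneous_zero _ _ _

theorem QDeg_le_comap_kameko (k m : ℕ) : QDeg k (2 * m + k) ≤ (QDeg k m).comap (kameko k) := by
  rintro _ ⟨f, hf, rfl⟩
  exact ⟨phi k f, isHomogeneous_phi k m hf, rfl⟩

theorem QDeg_le_comap_kameko_pow (k d t r : ℕ) :
    QDeg k (k * (2 ^ (t + r) - 1) + 2 ^ (t + r) * d) ≤
      (QDeg k (k * (2 ^ t - 1) + 2 ^ t * d)).comap (kameko k ^ r) := by
  induction r with
  | zero => exact fun x hx => hx
  | succ r ih =>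
    intro x hx
    have hdeg : k * (2 ^ (t + (r + 1)) - 1) + 2 ^ (t + (r + 1)) * d =
        2 * (k * (2 ^ (t + r) - 1) + 2 ^ (t + r) * d) + k := by
      obtain ⟨c, hc⟩ : ∃ c, 2 ^ (t + r) = c + 1 :=
        ⟨2 ^ (t + r) - 1, (Nat.sub_add_cancel Nat.one_le_two_pow).symm⟩
      rw [← add_assoc, pow_succ, hc, Nat.add_sub_cancel,
        show (c + 1) * 2 - 1 = 2 * c + 1 by omega]
      ring
    rw [hdeg] at hx
    have h := ih (QDeg_le_comap_kameko k _ hx)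
    rw [Submodule.mem_comap] at h ⊢
    rw [pow_succ, Module.End.mul_apply]
    exact h

/-- The iterated Kameko squaring operation
`(S̃q^0_*)^(s-t) : (𝔽₂ ⊗_𝒜 P_k)_(k(2^s-1)+2^s d) → (𝔽₂ ⊗_𝒜 P_k)_(k(2^t-1)+2^t d)`
for `s ≥ t`. -/
def kamekoIter (k d : ℕ) {t s : ℕ} (hts : t ≤ s) :
    QDeg k (k * (2 ^ s - 1) + 2 ^ s * d) →ₗ[ZMod 2] QDeg k (k * (2 ^ t - 1) + 2 ^ t * d) :=
  (kameko k ^ (s - t)).restrict fun x hx =>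
    QDeg_le_comap_kameko_pow k d t (s - t) (by rwa [Nat.add_sub_cancel' hts])

/-! ### The number `t(k, d)` -/

/-- The number `α(n)` of ones in the binary expansion of `n`. -/
def alpha (n : ℕ) : ℕ := (Nat.digits 2 n).count 1

/-- The greatest `u` such that `2 ^ u` divides the positive integer `n`. -/
def zeta (n : ℕ) : ℕ := padicValNat 2 n

/-- `t(k, d) = max {0, k - α(d + k) - ζ(d + k)}`. -/
def tInv (k d : ℕ) : ℤ := max 0 ((k : ℤ) - alpha (d + k) - zeta (d + k))

end HitProblem

end

namespace HitProblem

/-! ### Binary digit sums -/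

/-! Write `n_s = k(2^s - 1) + 2^s d`, so that `n_s + k = 2^s(d + k)`. Two facts hold in every
degree. The map `up : y ↦ x_1⋯x_k y²` satisfies `φ ∘ up = id`, so Kameko's operation is surjective.
Also `φ(h g²) = φ(h) g`, and `φ` sends the image of `x_1⋯x_k` under a matrix to its determinant,
which is 1 on `GL_k(𝔽₂)`, so the operation is equivariant (`phi_linSubst`). Only injectivity depends
on `s`.

The bridge to binary digits is `alpha (2^s(d+k) - 1) = alpha(d+k) + zeta(d+k) + s - 1`, which is at
least `k` exactly when `s > k - alpha(d+k) - zeta(d+k)`. A number `n` is a sum of `r` numbers `2^i -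
1` (zeros allowed) if and only if `alpha(n + r) ≤ r`.

For `s > t(k,d)`, subadditivity of `alpha` shows that `n_s` is not such a sum for any `r < k`. A
monomial with `r < k` odd exponents has the form `x_S z² = x_S Sq^{deg z}(z)`, and
`prod_X_mul_sq_mem_hit` makes it hit. Hence `ker φ` is hit in degree `n_s`. Modulo `ker φ` the map
`up` carries `Sq^i` to `Sq^{2i}`, so it preserves hit polynomials and inverts Kameko's operation
(`mem_hit_of_phi_mem_hit`).

For `0 < s ≤ t(k,d)`, there is a spike of degree `n_s` with some exponent zero. Spikes are never
hit, since the binomial coefficients that would produce them are even, but `φ` kills this one. If `t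
< t(k,d)`, taking `s = t(k,d)` therefore makes the iterate non-injective. -/

theorem alpha_zero : alpha 0 = 0 := by simp [alpha]

theorem alpha_two_mul (n : ℕ) : alpha (2 * n) = alpha n := by
  rcases Nat.eq_zero_or_pos n with rfl | hn
  · rfl
  · have h := Nat.digits_add 2 one_lt_two 0 n two_pos (Or.inr hn.ne')
    rw [zero_add] at h
    simp [alpha, h]

theorem alpha_two_mul_add_one (n : ℕ) : alpha (2 * n + 1) = alpha n + 1 := by
  have h := Nat.digits_add 2 one_lt_two 1 n one_lt_two (Or.inl one_ne_zero)
  rw [add_comm] at h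
  rw [alpha, h, List.count_cons_self, alpha]

theorem pos_of_alpha_pos {n : ℕ} (h : 0 < alpha n) : 0 < n := by
  rcases Nat.eq_zero_or_pos n with rfl | hn
  · rw [alpha_zero] at h
    exact h
  · exact hn

/-- Each carry in binary addition replaces two ones by a single one. -/
theorem alpha_add_le (a b : ℕ) : alpha (a + b) ≤ alpha a + alpha b := by
  have succ_le : ∀ n, alpha (n + 1) ≤ alpha n + 1 := by
    intro n
    induction n using Nat.strong_induction_on with
    | _ n ih =>
      obtain ⟨m, rfl | rfl⟩ := Nat.even_or_odd' n
      · rw [alpha_two_mul_add_one, alpha_two_mul]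
      · rw [show 2 * m + 1 + 1 = 2 * (m + 1) by ring, alpha_two_mul, alpha_two_mul_add_one]
        exact (ih m (by omega)).trans (Nat.le_succ _)
  induction a using Nat.strong_induction_on generalizing b with
  | _ a ih =>
    rcases Nat.eq_zero_or_pos a with rfl | ha
    · simp
    obtain ⟨m, rfl | rfl⟩ := Nat.even_or_odd' a <;> obtain ⟨l, rfl | rfl⟩ := Nat.even_or_odd' b <;>
      have h := ih m (by omega) l
    · rwa [← mul_add, alpha_two_mul, alpha_two_mul, alpha_two_mul]
    · rw [← add_assoc, ← mul_add, alpha_two_mul_add_one, alpha_two_mul, alpha_two_mul_add_one]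
      omega
    · rw [add_right_comm, ← mul_add, alpha_two_mul_add_one, alpha_two_mul, alpha_two_mul_add_one]
      omega
    · rw [show 2 * m + 1 + (2 * l + 1) = 2 * (m + l + 1) by ring, alpha_two_mul,
        alpha_two_mul_add_one, alpha_two_mul_add_one]
      have := succ_le (m + l)
      omega

theorem alpha_two_pow_mul (j n : ℕ) : alpha (2 ^ j * n) = alpha n := by
  induction j with
  | zero => rw [pow_zero, one_mul]
  | succ j ih => rw [pow_succ', mul_assoc, alpha_two_mul, ih]

theorem alpha_two_pow (j : ℕ) : alpha (2 ^ j) = 1 := by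
  rw [← mul_one (2 ^ j), alpha_two_pow_mul]
  simp [alpha]

theorem alpha_le_self (n : ℕ) : alpha n ≤ n := by
  induction n with
  | zero => rw [alpha_zero]
  | succ n ih =>
    have h := alpha_add_le n 1
    have h1 : alpha 1 = 1 := alpha_two_pow 0
    omega

/-- Subtracting one clears the lowest one and turns the `zeta n` zeros below it into ones. -/
theorem alpha_sub_one {n : ℕ} (hn : 0 < n) : alpha (n - 1) + 1 = alpha n + zeta n := by
  unfold zeta
  induction n using Nat.strong_induction_on with
  | _ n ih =>
    obtain ⟨m, rfl | rfl⟩ := Nat.even_or_odd' n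
    · rw [show 2 * m - 1 = 2 * (m - 1) + 1 by omega, alpha_two_mul_add_one, alpha_two_mul,
        padicValNat.mul two_ne_zero (by omega), padicValNat_self, ih m (by omega) (by omega)]
      ring
    · rw [Nat.add_sub_cancel, alpha_two_mul, alpha_two_mul_add_one,
        padicValNat.eq_zero_of_not_dvd (by omega)]

theorem alpha_two_pow_mul_sub_one (s : ℕ) {n : ℕ} (hn : 0 < n) :
    alpha (2 ^ s * n - 1) + 1 = alpha n + zeta n + s := by
  rw [alpha_sub_one (by positivity), alpha_two_pow_mul]
  unfold zeta
  rw [padicValNat.mul (by positivity) hn.ne', padicValNat.prime_pow]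
  ring

theorem exists_sum_two_pow (n : ℕ) :
    ∃ s : Multiset ℕ, s.card = alpha n ∧ (s.map (2 ^ ·)).sum = n := by
  induction n using Nat.strong_induction_on with
  | _ n ih =>
    rcases Nat.eq_zero_or_pos n with rfl | hn
    · exact ⟨0, by simp [alpha_zero]⟩
    obtain ⟨m, h⟩ := Nat.even_or_odd' n
    obtain ⟨s, hs, hsum⟩ := ih m (by omega)
    have hdouble : ((s.map (· + 1)).map (2 ^ ·)).sum = 2 * m := by
      rw [Multiset.map_map]
      simp only [Function.comp_apply, pow_succ', Multiset.sum_map_mul_left, hsum]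
    rcases h with rfl | rfl
    · exact ⟨s.map (· + 1), by rw [Multiset.card_map, hs, alpha_two_mul], hdouble⟩
    · refine ⟨0 ::ₘ s.map (· + 1), ?_, ?_⟩
      · rw [Multiset.card_cons, Multiset.card_map, hs, alpha_two_mul_add_one]
      · rw [Multiset.map_cons, Multiset.sum_cons, hdouble, pow_zero, add_comm]

/-- Start from the binary expansion and split `2^(b+1) = 2^b + 2^b`, gaining one summand each time.
This is possible until all summands are 1, when there are already `n` of them. -/
theorem exists_sum_two_pow_of_le {n r : ℕ} (h : alpha n ≤ r) (hr : r ≤ n) :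
    ∃ s : Multiset ℕ, s.card = r ∧ (s.map (2 ^ ·)).sum = n := by
  induction r, h using Nat.le_induction with
  | base => exact exists_sum_two_pow n
  | succ r _ ih =>
    obtain ⟨s, hs, hsum⟩ := ih (by omega)
    have hex : ∃ a ∈ s, a ≠ 0 := by
      by_contra! h0
      have h1 : s.map (2 ^ ·) = s.map fun _ => 1 :=
        Multiset.map_congr rfl fun a ha => by rw [h0 a ha, pow_zero]
      rw [h1, Multiset.map_const', Multiset.sum_replicate] at hsum
      simp only [smul_eq_mul, mul_one] at hsum
      omega
    obtain ⟨a, ha, ha0⟩ := hex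
    obtain ⟨s, rfl⟩ := Multiset.exists_cons_of_mem ha
    obtain ⟨b, rfl⟩ := Nat.exists_eq_succ_of_ne_zero ha0
    refine ⟨b ::ₘ b ::ₘ s, ?_, ?_⟩
    · simpa using hs
    · simp only [Multiset.map_cons, Multiset.sum_cons] at hsum ⊢
      rw [← hsum, Nat.succ_eq_add_one, pow_succ]
      ring

/-- The binary digits of `b` and `f` are complementary, so `b` has a zero wherever `f` has a one,
and Lucas' theorem gives a factor `0 choose 1`. -/
theorem even_choose_of_add_eq_two_pow_sub_one {b f d : ℕ} (h : b + f + 1 = 2 ^ d) (hf : f ≠ 0) :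
    (b.choose f : ZMod 2) = 0 := by
  induction d generalizing b f with
  | zero => rw [pow_zero] at h; omega
  | succ d ih =>
    have hl := Choose.choose_modEq_choose_mod_mul_choose_div_nat (n := b) (k := f) (p := 2)
    rw [← ZMod.natCast_eq_natCast_iff] at hl
    rw [hl, Nat.cast_mul]
    rw [pow_succ] at h
    rcases Nat.mod_two_eq_zero_or_one f with h0 | h1
    · rw [ih (b := b / 2) (f := f / 2) (by omega) (by omega), mul_zero]
    · rw [h1, show b % 2 = 0 by omega]
      simp

open MvPolynomial

/-! ### Hit polynomials -/

/-- By Frobenius, the total square of `x^(2^j)` has just two terms, `x^(2^j)` and `x^(2^(j+1))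
T^(2^j)`. -/
theorem sq_X_pow_two_pow_mul (k e j : ℕ) (i : Fin k) (v : P k) :
    sq k e (X i ^ 2 ^ j * v) = X i ^ 2 ^ j * sq k e v +
      if 2 ^ j ≤ e then X i ^ 2 ^ (j + 1) * sq k (e - 2 ^ j) v else 0 := by
  have h : totalSq k (X i ^ 2 ^ j * v) = Polynomial.C (X i ^ 2 ^ j) * totalSq k v +
      Polynomial.C (X i ^ 2 ^ (j + 1)) * (Polynomial.X ^ 2 ^ j * totalSq k v) := by
    rw [map_mul, map_pow, totalSq_X, add_pow_char_pow, mul_pow, ← Polynomial.C_pow,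
      ← Polynomial.C_pow, ← pow_mul, ← pow_succ', add_mul, mul_assoc]
  simp only [sq_apply, h, Polynomial.coeff_add, Polynomial.coeff_C_mul,
    Polynomial.coeff_X_pow_mul']
  rw [mul_ite, mul_zero]

/-- If `u` is a product of `a` distinct variables and `e` is not a sum of at most `a` numbers of
the form `2 ^ i - 1`, then `u * Sq^e v` is hit. -/
theorem prod_X_mul_sq_mem_hit (k : ℕ) (S : Finset (Fin k)) {e : ℕ}
    (he : S.card < alpha (e + S.card)) (v : P k) : (∏ j ∈ S, X j) * sq k e v ∈ hit k := by
  induction S using Finset.induction_on generalizing e v with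
  | empty =>
    rw [Finset.prod_empty, one_mul]
    exact sq_mem_hit k (pos_of_alpha_pos (by simpa using he)) v
  | insert i S hi ih =>
    rw [Finset.card_insert_of_notMem hi] at he
    -- Generalizing the new variable to its `2^j`-th power lets the error term of the Cartan formula
    -- be absorbed by induction on `e`; only `j = 0` is needed at the end.
    have key : ∀ e j : ℕ, S.card + 1 < alpha (e + S.card + 2 ^ j) →
        (∏ j ∈ S, X j) * (X i ^ 2 ^ j * sq k e v) ∈ hit k := by
      intro e
      induction e using Nat.strong_induction_on with
      | _ e ihe =>
        intro j hj
        -- Removing `2^j` lowers `alpha` by at most one, so the induction hypothesis for `S` applies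
        -- to the polynomial `x_i^(2^j) v`.
        have h1 : (∏ j ∈ S, X j) * sq k e (X i ^ 2 ^ j * v) ∈ hit k := by
          refine ih ?_ _
          have := alpha_add_le (e + S.card) (2 ^ j)
          rw [alpha_two_pow] at this
          omega
        have h2 : (∏ j ∈ S, X j) * (if 2 ^ j ≤ e then X i ^ 2 ^ (j + 1) * sq k (e - 2 ^ j) v
            else 0) ∈ hit k := by
          split_ifs with hje
          · have := Nat.two_pow_pos j
            refine ihe _ (by omega) _ ?_
            -- Passing from `(e, j)` to `(e - 2^j, j + 1)` leaves `e + |S| + 2^j` unchanged, so the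
            -- digit condition persists.
            rwa [show e - 2 ^ j + S.card + 2 ^ (j + 1) = e + S.card + 2 ^ j by
              rw [pow_succ]; omega]
          · rw [mul_zero]
            exact (hit k).zero_mem
        have h3 := (hit k).sub_mem h1 h2
        rwa [← mul_sub, sq_X_pow_two_pow_mul, add_sub_cancel_right] at h3
    have h := key e 0 (by rwa [pow_zero, add_assoc])
    rwa [pow_zero, pow_one, ← mul_assoc, mul_comm _ (X i), ← Finset.prod_insert hi] at h

theorem monomial_eq_prod_mul_sq (k : ℕ) (e : Fin k →₀ ℕ) :
    (monomial e 1 : P k) = (∏ j ∈ Finset.univ.filter (fun j : Fin k => Odd (e j)), X j) *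
      monomial (e.mapRange (fun m : ℕ => m / 2) (Nat.zero_div 2)) 1 ^ 2 := by
  have h : (∏ j ∈ Finset.univ.filter (fun j : Fin k => Odd (e j)), X j : P k) =
      monomial (∑ j ∈ Finset.univ.filter (fun j : Fin k => Odd (e j)), Finsupp.single j 1) 1 := by
    rw [monomial_sum_one]
    rfl
  rw [h, monomial_pow, monomial_mul, one_pow, one_mul]
  refine congrArg (fun x => monomial x (1 : ZMod 2)) (Finsupp.ext fun i => ?_)
  rw [Finsupp.add_apply, Finsupp.finsetSum_apply, Finsupp.smul_apply, Finsupp.mapRange_apply]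
  simp only [Finsupp.single_apply, Finset.sum_ite_eq', Finset.mem_filter, Finset.mem_univ,
    true_and, Nat.odd_iff, smul_eq_mul]
  split_ifs <;> omega

theorem monomial_eq_smul {k : ℕ} (e : Fin k →₀ ℕ) (r : ZMod 2) :
    (monomial e r : P k) = r • monomial e 1 := by
  rw [smul_monomial, smul_eq_mul, mul_one]

theorem totalSq_monomial (k : ℕ) (b : Fin k →₀ ℕ) :
    totalSq k (monomial b 1) = ∑ f ∈ Fintype.piFinset fun j => Finset.range (b j + 1),
      Polynomial.C (monomial (b + Finsupp.equivFunOnFinite.symm f)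
        (∏ j, ((b j).choose (f j) : ZMod 2))) * Polynomial.X ^ ∑ j, f j := by
  have hX : ∀ (j : Fin k) (n : ℕ), totalSq k (X j ^ n) = ∑ m ∈ Finset.range (n + 1),
      Polynomial.C (X j ^ (n + m) * C (n.choose m : ZMod 2)) * Polynomial.X ^ m := by
    intro j n
    rw [map_pow, totalSq_X, add_comm, add_pow]
    refine Finset.sum_congr rfl fun m hm => ?_
    rw [Finset.mem_range] at hm
    have hp : (X j ^ (n + m) : P k) = (X j ^ 2) ^ m * X j ^ (n - m) := by
      rw [← pow_mul, ← pow_add]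
      congr 1
      omega
    rw [hp]
    simp only [mul_pow, map_mul, map_pow, map_natCast]
    ring
  rw [monomial_eq, C_1, one_mul, Finsupp.prod_fintype _ _ fun j => pow_zero _, map_prod,
    Finset.prod_congr rfl fun j _ => hX j (b j), Finset.prod_univ_sum]
  refine Finset.sum_congr rfl fun f _ => ?_
  rw [Finset.prod_mul_distrib, Finset.prod_pow_eq_pow_sum, ← map_prod, Finset.prod_mul_distrib,
    ← map_prod, mul_comm _ (C _), monomial_eq, Finsupp.prod_fintype _ _ fun j => pow_zero _]
  rfl

theorem sq_monomial (k i : ℕ) (b : Fin k →₀ ℕ) :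
    sq k i (monomial b 1) = ∑ f ∈ (Fintype.piFinset fun j => Finset.range (b j + 1)) with
      ∑ j, f j = i, monomial (b + Finsupp.equivFunOnFinite.symm f)
        (∏ j, ((b j).choose (f j) : ZMod 2)) := by
  rw [sq_apply, totalSq_monomial, Polynomial.finsetSum_coeff, Finset.sum_filter]
  refine Finset.sum_congr rfl fun f _ => ?_
  rw [Polynomial.coeff_C_mul_X_pow]
  simp only [eq_comm]

theorem sq_monomial_degree (k : ℕ) (b : Fin k →₀ ℕ) :
    sq k b.degree (monomial b 1) = monomial b 1 ^ 2 := by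
  rw [sq_monomial, monomial_pow, one_pow, two_nsmul]
  have hb : Finsupp.equivFunOnFinite.symm (b : Fin k → ℕ) = b :=
    Finsupp.equivFunOnFinite.symm_apply_apply b
  rw [Finset.sum_eq_single_of_mem (b : Fin k → ℕ)]
  · simp [hb]
  · simp [Finsupp.degree_eq_sum]
  · intro f hf hne
    rw [Finset.mem_filter, Fintype.mem_piFinset, Finsupp.degree_eq_sum] at hf
    refine absurd (funext fun j => ?_) hne
    have hle : ∀ j ∈ Finset.univ, f j ≤ b j := fun j _ => by
      have := Finset.mem_range.1 (hf.1 j)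
      omega
    -- In top degree every factor `x + x²T` must contribute `x²T`.
    exact (Finset.sum_eq_sum_iff_of_le hle).1 hf.2 j (Finset.mem_univ j)

theorem isHomogeneous_sq_monomial (k i : ℕ) (b : Fin k →₀ ℕ) :
    (sq k i (monomial b 1)).IsHomogeneous (b.degree + i) := by
  rw [sq_monomial]
  refine IsHomogeneous.sum _ _ _ fun f hf => isHomogeneous_monomial _ ?_
  rw [Finset.mem_filter] at hf
  rw [map_add, ← hf.2, Finsupp.degree_eq_sum (Finsupp.equivFunOnFinite.symm f)]
  rfl

theorem isHomogeneous_sq (k i n : ℕ) {f : P k} (hf : f.IsHomogeneous n) :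
    (sq k i f).IsHomogeneous (n + i) := by
  rw [f.as_sum, map_sum]
  refine IsHomogeneous.sum _ _ _ fun e he => ?_
  have hdeg := hf (mem_support_iff.1 he)
  rw [monomial_eq_smul e, map_smul]
  refine (homogeneousSubmodule (Fin k) (ZMod 2) (n + i)).smul_mem _ ?_
  have hd : e.degree = n := by
    rw [← hdeg, Finsupp.degree_eq_weight_one]
    rfl
  rw [mem_homogeneousSubmodule, ← hd]
  exact isHomogeneous_sq_monomial k i e

/-- A spike, i.e. a monomial all of whose exponents are of the form `2 ^ a - 1`, is not hit. -/
theorem spike_notMem_hit (k : ℕ) (c : Fin k →₀ ℕ) (hc : ∀ j, ∃ a, c j + 1 = 2 ^ a) :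
    (monomial c 1 : P k) ∉ hit k := by
  -- The coefficient of the spike is a linear functional that vanishes on all `Sq^i(g)` with `i >
  -- 0`: some exponent increases strictly, and the corresponding binomial coefficient is even.
  have hle : hit k ≤ LinearMap.ker (lcoeff (ZMod 2) c) := by
    refine hit_le k _ fun i hi g => ?_
    induction g using MvPolynomial.induction_on' with
    | monomial b r =>
      rw [monomial_eq_smul b r, map_smul]
      refine Submodule.smul_mem _ _ ?_
      rw [LinearMap.mem_ker, lcoeff_apply, sq_monomial, coeff_sum]
      refine Finset.sum_eq_zero fun f hf => ?_
      rw [Finset.mem_filter] at hf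
      rw [coeff_monomial]
      split_ifs with hbc
      · obtain ⟨j, -, hj⟩ := Finset.exists_ne_zero_of_sum_ne_zero (by rw [hf.2]; exact hi.ne')
        obtain ⟨a, ha⟩ := hc j
        refine Finset.prod_eq_zero (Finset.mem_univ j)
          (even_choose_of_add_eq_two_pow_sub_one (d := a) ?_ hj)
        rw [← ha, ← hbc]
        rfl
      · rfl
    | add p q hp hq =>
      rw [map_add]
      exact Submodule.add_mem _ hp hq
  intro h
  have := hle h
  rw [LinearMap.mem_ker, lcoeff_apply, coeff_monomial, if_pos rfl] at this
  exact one_ne_zero this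

/-! ### Kameko's operation is injective in large degrees -/

/-- With `S` the set of odd exponents and `z` the halved monomial, `z² = Sq^{deg z}(z)`. Since `n +
|S| = 2(deg z + |S|)`, the hypothesis at `r = |S|` is the digit condition of
`prod_X_mul_sq_mem_hit`. -/
theorem monomial_mem_hit (k n : ℕ) (hn : ∀ r < k, r < alpha (n + r)) {e : Fin k →₀ ℕ}
    (he : e.degree = n) (hodd : ¬ ∀ j, Odd (e j)) : (monomial e 1 : P k) ∈ hit k := by
  rw [monomial_eq_prod_mul_sq, ← sq_monomial_degree]
  set S := Finset.univ.filter fun j : Fin k => Odd (e j)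
  set z := e.mapRange (fun m : ℕ => m / 2) (Nat.zero_div 2)
  have hS : S.card < k := by
    refine (Finset.card_lt_card (Finset.filter_ssubset.2 ?_)).trans_eq (Finset.card_fin k)
    push Not at hodd
    obtain ⟨j, hj⟩ := hodd
    exact ⟨j, Finset.mem_univ j, hj⟩
  have hsum : n = 2 * z.degree + S.card := by
    rw [← he, Finsupp.degree_eq_sum, Finsupp.degree_eq_sum, Finset.card_filter, Finset.mul_sum,
      ← Finset.sum_add_distrib]
    refine Finset.sum_congr rfl fun j _ => ?_
    rw [Finsupp.mapRange_apply]
    simp only [Nat.odd_iff]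
    split_ifs <;> omega
  refine prod_X_mul_sq_mem_hit k S ?_ _
  have h := hn _ hS
  rwa [hsum, show 2 * z.degree + S.card + S.card = 2 * (z.degree + S.card) by ring,
    alpha_two_mul] at h

/-- Halving is injective on vectors of odd exponents, so `φ` loses nothing on monomials of that
kind; a kernel element therefore contains none of them. -/
theorem coeff_phi (k : ℕ) (f : P k) (e : Fin k →₀ ℕ) (he : ∀ j, Odd (e j)) :
    coeff (e.mapRange (fun m : ℕ => m / 2) (Nat.zero_div 2)) (phi k f) = coeff e f := by
  induction f using MvPolynomial.induction_on' with
  | monomial b r =>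
    rw [monomial_eq_smul b r, map_smul, coeff_smul, coeff_smul, phi_monomial, coeff_monomial]
    congr 1
    by_cases hb : ∀ j, Odd (b j)
    · rw [if_pos hb, coeff_monomial]
      refine if_congr ⟨fun h => Finsupp.ext fun j => ?_, fun h => by rw [h]⟩ rfl rfl
      have h1 := DFunLike.congr_fun h j
      have h2 := Nat.odd_iff.1 (hb j)
      have h3 := Nat.odd_iff.1 (he j)
      simp only [Finsupp.mapRange_apply] at h1
      omega
    · rw [if_neg hb, coeff_zero, if_neg]
      rintro rfl
      exact hb he
  | add p q hp hq => rw [map_add, coeff_add, coeff_add, hp, hq]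

theorem mem_hit_of_phi_eq_zero (k n : ℕ) (hn : ∀ r < k, r < alpha (n + r)) {f : P k}
    (hf : f.IsHomogeneous n) (hphi : phi k f = 0) : f ∈ hit k := by
  rw [f.as_sum]
  refine (hit k).sum_mem fun e he => ?_
  rw [monomial_eq_smul e]
  refine (hit k).smul_mem _ (monomial_mem_hit k n hn ?_ fun hodd => ?_)
  · rw [← hf (mem_support_iff.1 he), Finsupp.degree_eq_weight_one]
    rfl
  · refine mem_support_iff.1 he ?_
    rw [← coeff_phi k f e hodd, hphi, coeff_zero]

/-- The map `y ↦ x_1 ⋯ x_k y ^ 2`. -/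
noncomputable def up (k : ℕ) : P k →ₗ[ZMod 2] P k :=
  (LinearMap.mulLeft (ZMod 2) (∏ j, X j)).comp
    (AddMonoidHom.toZModLinearMap 2 (frobenius (P k) 2).toAddMonoidHom)

theorem up_apply (k : ℕ) (y : P k) : up k y = (∏ j, X j) * y ^ 2 := rfl

theorem phi_up (k : ℕ) (y : P k) : phi k (up k y) = y := by
  rw [up_apply, phi_mul_sq, phi_prod_X, if_pos rfl, one_mul]

theorem isHomogeneous_up (k m : ℕ) {y : P k} (hy : y.IsHomogeneous m) :
    (up k y).IsHomogeneous (2 * m + k) := by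
  have h1 : (∏ j, X j : P k).IsHomogeneous k := by
    have := IsHomogeneous.prod Finset.univ (fun j : Fin k => (X j : P k)) (fun _ => 1)
      fun j _ => isHomogeneous_X _ _
    simpa using this
  have h := h1.mul (hy.pow 2)
  rwa [add_comm, mul_comm m] at h

theorem up_mem_hit (k m : ℕ) (hn : ∀ r < k, r < alpha (2 * m + k + r)) {y : P k}
    (hy : y.IsHomogeneous m) (hyhit : y ∈ hit k) : up k y ∈ hit k := by
  -- The generators `Sq^i(g)` of `hit k` need not be homogeneous, while the digit condition concerns
  -- one degree only; hence the projection to degree `m`.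
  have hle : hit k ≤ (hit k).comap ((up k).comp (homogeneousComponent m)) := by
    refine hit_le k _ fun i hi g => ?_
    induction g using MvPolynomial.induction_on' with
    | monomial b r =>
      rw [monomial_eq_smul b r, map_smul]
      refine Submodule.smul_mem _ _ ?_
      have hb := isHomogeneous_sq_monomial k i b
      rw [Submodule.mem_comap, LinearMap.comp_apply, homogeneousComponent_of_mem hb]
      split_ifs with hm
      · have hb1 : (monomial b 1 : P k).IsHomogeneous b.degree := isHomogeneous_monomial _ rfl
        have h1 : sq k (2 * i) (up k (monomial b 1)) ∈ hit k := sq_mem_hit k (by omega) _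
        -- The difference lies in `ker φ`, because `φ Sq^{2i} up = Sq^i φ up = Sq^i`.
        have h2 : up k (sq k i (monomial b 1)) - sq k (2 * i) (up k (monomial b 1)) ∈ hit k := by
          refine mem_hit_of_phi_eq_zero k _ hn ?_ ?_
          · refine IsHomogeneous.sub (isHomogeneous_up k m (by rwa [hm])) ?_
            have := isHomogeneous_sq k (2 * i) _ (isHomogeneous_up k _ hb1)
            rwa [show 2 * b.degree + k + 2 * i = 2 * m + k by omega] at this
          · rw [map_sub, phi_up, phi_sq, if_pos (dvd_mul_right 2 i), phi_up,
              Nat.mul_div_cancel_left i two_pos, sub_self]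
        simpa using (hit k).add_mem h2 h1
      · rw [map_zero]
        exact (hit k).zero_mem
    | add p q hp hq =>
      rw [map_add]
      exact Submodule.add_mem _ hp hq
  have h := hle hyhit
  rwa [Submodule.mem_comap, LinearMap.comp_apply, homogeneousComponent_of_mem hy,
    if_pos rfl] at h

theorem mem_hit_of_phi_mem_hit (k m : ℕ) (hn : ∀ r < k, r < alpha (2 * m + k + r)) {f : P k}
    (hf : f.IsHomogeneous (2 * m + k)) (hphi : phi k f ∈ hit k) : f ∈ hit k := by
  have hm := isHomogeneous_phi k m hf
  have h1 : f - up k (phi k f) ∈ hit k := by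
    refine mem_hit_of_phi_eq_zero k _ hn (hf.sub (isHomogeneous_up k m hm)) ?_
    rw [map_sub, phi_up, sub_self]
  simpa using (hit k).add_mem h1 (up_mem_hit k m hn hm hphi)

/-! ### Kameko's operation is equivariant -/

theorem phi_eq_zero_of_degree_lt (k : ℕ) {n : ℕ} (hn : n < k) {f : P k} (hf : f.IsHomogeneous n) :
    phi k f = 0 := by
  rw [f.as_sum, map_sum]
  refine Finset.sum_eq_zero fun e he => ?_
  have hdeg : e.degree = n := by
    rw [← hf (mem_support_iff.1 he), Finsupp.degree_eq_weight_one]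
    rfl
  rw [monomial_eq_smul e, map_smul, phi_monomial, if_neg, smul_zero]
  intro hodd
  have h : ∑ _j : Fin k, 1 ≤ ∑ j, e j := Finset.sum_le_sum fun j _ => (hodd j).pos
  rw [← Finsupp.degree_eq_sum, hdeg] at h
  simp only [Finset.sum_const, Finset.card_univ, Fintype.card_fin, smul_eq_mul, mul_one] at h
  omega

theorem phi_prod_X_comp (k : ℕ) (σ : Fin k → Fin k) :
    phi k (∏ j, X (σ j)) = if Function.Bijective σ then 1 else 0 := by
  split_ifs with hσ
  · rw [hσ.prod_comp (fun j => (X j : P k)), phi_prod_X, if_pos rfl]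
  · have h : (∏ j, X (σ j) : P k) = monomial (∑ j, Finsupp.single (σ j) 1) 1 := by
      rw [monomial_sum_one]
      rfl
    rw [h, phi_monomial, if_neg]
    intro hodd
    refine hσ (Finite.surjective_iff_bijective.1 fun i => ?_)
    by_contra! hi
    have h0 : (∑ j, Finsupp.single (σ j) 1 : Fin k →₀ ℕ) i = 0 := by
      rw [Finsupp.finsetSum_apply]
      exact Finset.sum_eq_zero fun j _ => Finsupp.single_eq_of_ne (hi j).symm
    have := hodd i
    rw [h0] at this
    exact absurd this (by decide)

/-- Expanding the product of linear forms, `φ` keeps only the terms in which each variable occurs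
once. This gives the permanent of `M`, which is its determinant in characteristic 2. -/
theorem phi_linSubst_prod_X (k : ℕ) (M : Matrix (Fin k) (Fin k) (ZMod 2)) :
    phi k (linSubst k M (∏ j, X j)) = C M.det := by
  rw [map_prod, Finset.prod_congr rfl fun j _ => linSubst_X k M j, Finset.prod_univ_sum, map_sum,
    Fintype.piFinset_univ]
  have hterm : ∀ σ : Fin k → Fin k, phi k (∏ j, C (M (σ j) j) * X (σ j)) =
      if Function.Bijective σ then C (∏ j, M (σ j) j) else 0 := by
    intro σ
    rw [Finset.prod_mul_distrib, ← map_prod, ← smul_eq_C_mul, map_smul, phi_prod_X_comp, smul_ite,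
      smul_zero, smul_eq_C_mul, mul_one]
  rw [Finset.sum_congr rfl fun σ _ => hterm σ, ← Finset.sum_filter, Matrix.det_apply, map_sum]
  symm
  refine Finset.sum_bij (fun σ _ => (σ : Fin k → Fin k)) ?_ ?_ ?_ ?_
  · intro σ _
    exact Finset.mem_filter.2 ⟨Finset.mem_univ _, σ.bijective⟩
  · intro σ _ τ _ h
    exact DFunLike.coe_injective h
  · intro σ hσ
    rw [Finset.mem_filter] at hσ
    exact ⟨Equiv.ofBijective σ hσ.2, Finset.mem_univ _, rfl⟩
  · intro σ _
    rcases Int.units_eq_one_or (Equiv.Perm.sign σ) with h | h <;> rw [h]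
    · rw [one_smul]
    · rw [Units.neg_smul, one_smul, CharTwo.neg_eq]

theorem phi_linSubst (k : ℕ) (M : Matrix (Fin k) (Fin k) (ZMod 2)) (hM : M.det = 1) (f : P k) :
    phi k (linSubst k M f) = linSubst k M (phi k f) := by
  induction f using MvPolynomial.induction_on' with
  | monomial b r =>
    rw [monomial_eq_smul b r, map_smul, map_smul, map_smul, map_smul, monomial_eq_prod_mul_sq]
    congr 1
    generalize (monomial (b.mapRange (fun m : ℕ => m / 2) (Nat.zero_div 2)) 1 : P k) = z
    generalize Finset.univ.filter (fun j : Fin k => Odd (b j)) = S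
    rw [map_mul, map_pow, phi_mul_sq, phi_mul_sq, map_mul, phi_prod_X]
    congr 1
    split_ifs with hS
    · rw [hS, phi_linSubst_prod_X, hM, C_1, map_one]
    · rw [map_zero]
      refine phi_eq_zero_of_degree_lt k (n := S.card) ?_ (isHomogeneous_linSubst k M ?_)
      -- A linear substitution preserves the degree `|S| < k`, and `φ` vanishes in degrees below
      -- `k`.
      · simpa using Finset.card_lt_univ_of_notMem
          (not_forall.1 (mt Finset.eq_univ_iff_forall.2 hS)).choose_spec
      · simpa using IsHomogeneous.prod S (fun j : Fin k => (X j : P k)) (fun _ => 1)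
          fun j _ => isHomogeneous_X _ _
  | add p q hp hq => simp only [map_add, hp, hq]

theorem kameko_glQ (k : ℕ) (g : GL (Fin k) (ZMod 2)) (x : Q k) :
    kameko k (glQ k g x) = glQ k g (kameko k x) := by
  obtain ⟨f, rfl⟩ := (hit k).mkQ_surjective x
  have hdet : g.1.det = 1 := by
    have h0 : g.1.det ≠ 0 := ((Matrix.isUnit_iff_isUnit_det _).1 g.isUnit).ne_zero
    have hsc : ∀ c : ZMod 2, c ≠ 0 → c = 1 := by decide
    exact hsc _ h0
  exact congrArg (hit k).mkQ (phi_linSubst k g.1 hdet f)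

theorem kameko_pow_glQ (k r : ℕ) (g : GL (Fin k) (ZMod 2)) (x : Q k) :
    (kameko k ^ r) (glQ k g x) = glQ k g ((kameko k ^ r) x) := by
  induction r with
  | zero => rfl
  | succ r ih => rw [pow_succ', Module.End.mul_apply, ih, kameko_glQ, Module.End.mul_apply]

/-! ### Bijectivity of the iterated operation -/

theorem kameko_degree_succ (k d s : ℕ) : k * (2 ^ (s + 1) - 1) + 2 ^ (s + 1) * d =
    2 * (k * (2 ^ s - 1) + 2 ^ s * d) + k := by
  obtain ⟨c, hc⟩ : ∃ c, 2 ^ s = c + 1 :=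
    ⟨2 ^ s - 1, (Nat.sub_add_cancel Nat.one_le_two_pow).symm⟩
  rw [pow_succ, hc, Nat.add_sub_cancel, show (c + 1) * 2 - 1 = 2 * c + 1 by omega]
  ring

theorem kameko_degree_add (k d s : ℕ) :
    k * (2 ^ s - 1) + 2 ^ s * d + k = 2 ^ s * (d + k) := by
  obtain ⟨c, hc⟩ : ∃ c, 2 ^ s = c + 1 :=
    ⟨2 ^ s - 1, (Nat.sub_add_cancel Nat.one_le_two_pow).symm⟩
  rw [hc, Nat.add_sub_cancel]
  ring

theorem kameko_surjOn (k m : ℕ) {y : Q k} (hy : y ∈ QDeg k m) :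
    ∃ x ∈ QDeg k (2 * m + k), kameko k x = y := by
  obtain ⟨f, hf, rfl⟩ := hy
  exact ⟨(hit k).mkQ (up k f), ⟨up k f, isHomogeneous_up k m hf, rfl⟩,
    congrArg (hit k).mkQ (phi_up k f)⟩

theorem kameko_pow_surjOn (k d t r : ℕ) {y : Q k}
    (hy : y ∈ QDeg k (k * (2 ^ t - 1) + 2 ^ t * d)) :
    ∃ x ∈ QDeg k (k * (2 ^ (t + r) - 1) + 2 ^ (t + r) * d), (kameko k ^ r) x = y := by
  induction r with
  | zero => exact ⟨y, hy, rfl⟩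
  | succ r ih =>
    obtain ⟨x, hx, rfl⟩ := ih
    obtain ⟨z, hz, rfl⟩ := kameko_surjOn k _ hx
    refine ⟨z, ?_, by rw [pow_succ, Module.End.mul_apply]⟩
    rwa [← add_assoc, kameko_degree_succ]

/-- Above `t(k, d)`, the degree is not a sum of fewer than `k` numbers of the form `2 ^ a - 1`. -/
theorem lt_alpha_of_tInv_lt (k d s : ℕ) (hkd : 0 < d + k) (hs : tInv k d < s) :
    ∀ r < k, r < alpha (k * (2 ^ s - 1) + 2 ^ s * d + r) := by
  intro r hr
  have h1 := alpha_two_pow_mul_sub_one s hkd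
  have h2 := kameko_degree_add k d s
  have h3 := alpha_add_le (k * (2 ^ s - 1) + 2 ^ s * d + r) (k - r - 1)
  have h4 := alpha_le_self (k - r - 1)
  -- Adding `k - r - 1` raises `alpha` by at most `k - r - 1`, and the total `2^s(d + k) - 1` has at
  -- least `k` ones, so at least `r + 1` come from the degree plus `r`.
  rw [show k * (2 ^ s - 1) + 2 ^ s * d + r + (k - r - 1) = 2 ^ s * (d + k) - 1 by omega] at h3
  rw [tInv, max_lt_iff] at hs
  omega

theorem kameko_pow_injOn (k d t r : ℕ) (hkd : 0 < d + k) (ht : tInv k d ≤ t) {x : Q k}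
    (hx : x ∈ QDeg k (k * (2 ^ (t + r) - 1) + 2 ^ (t + r) * d)) (h0 : (kameko k ^ r) x = 0) :
    x = 0 := by
  induction r generalizing x with
  | zero => exact h0
  | succ r ih =>
    -- The digit condition is needed in the source degree of each single step, with index `t + r +
    -- 1`. This index strictly exceeds `t(k,d)` even when `t = t(k,d)`.
    have hn := lt_alpha_of_tInv_lt k d (t + r + 1) hkd (by push_cast; omega)
    rw [← add_assoc, kameko_degree_succ] at hx
    rw [kameko_degree_succ] at hn
    rw [pow_succ, Module.End.mul_apply] at h0
    have h1 := ih (QDeg_le_comap_kameko k _ hx) h0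
    obtain ⟨f, hf, rfl⟩ := hx
    exact (Submodule.Quotient.mk_eq_zero _).2
      (mem_hit_of_phi_mem_hit k _ hn hf ((Submodule.Quotient.mk_eq_zero _).1 h1))

/-- Up to `t(k, d)`, there is a spike in which not all variables occur. -/
theorem exists_spike (k d s : ℕ) (hkd : 0 < d + k) (hs0 : 0 < s) (hs : s ≤ tInv k d) :
    ∃ c : Fin k →₀ ℕ, (∀ j, ∃ a, c j + 1 = 2 ^ a) ∧ (∃ j, c j = 0) ∧
      c.degree = k * (2 ^ s - 1) + 2 ^ s * d := by
  have h1 := alpha_two_pow_mul_sub_one s hkd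
  have h2 := kameko_degree_add k d s
  rw [tInv, le_max_iff] at hs
  -- Writing `2^s(d + k) - 1` as `k - 1` powers of two and adding `2^0` gives `k` powers with sum
  -- `n_s + k`. Lowering each by one yields the spike, and the added `2^0` becomes its zero
  -- exponent.
  obtain ⟨S, hcard, hsum⟩ := exists_sum_two_pow_of_le
    (n := 2 ^ s * (d + k) - 1) (r := k - 1) (by omega) (by omega)
  obtain ⟨l, hl⟩ : ∃ l : List ℕ, (l : Multiset ℕ) = 0 ::ₘ S := ⟨_, Multiset.coe_toList _⟩
  have hlen : l.length = k := by
    rw [← Multiset.coe_card, hl, Multiset.card_cons, hcard]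
    omega
  have hlsum : (l.map (2 ^ ·)).sum = 2 ^ s * (d + k) := by
    rw [← Multiset.sum_coe, ← Multiset.map_coe, hl, Multiset.map_cons, Multiset.sum_cons, hsum]
    omega
  have hmem : 0 ∈ l := by
    rw [← Multiset.mem_coe, hl]
    exact Multiset.mem_cons_self 0 S
  clear hl
  subst hlen
  have hpos : ∀ a, 2 ^ a - 1 + 1 = 2 ^ a := fun a => Nat.sub_add_cancel Nat.one_le_two_pow
  refine ⟨Finsupp.equivFunOnFinite.symm fun j => 2 ^ l[j] - 1, fun j => ⟨l[j], hpos _⟩, ?_, ?_⟩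
  · obtain ⟨i, hi, h0⟩ := List.getElem_of_mem hmem
    refine ⟨⟨i, hi⟩, ?_⟩
    rw [Finsupp.equivFunOnFinite_symm_apply_apply]
    simp [h0]
  · have h3 : ∑ j : Fin l.length, (2 ^ l[j] - 1 + 1) = 2 ^ s * (d + l.length) := by
      rw [← hlsum, ← Fin.sum_univ_fun_getElem]
      exact Finset.sum_congr rfl fun j _ => hpos _
    rw [Finset.sum_add_distrib, Finset.sum_const, Finset.card_univ, Fintype.card_fin, smul_eq_mul,
      mul_one, ← h2] at h3
    rw [Finsupp.degree_eq_sum]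
    exact Nat.add_right_cancel h3

/-- Up to `t(k, d)`, Kameko's operation is not injective. -/
theorem exists_ne_zero_kameko_eq_zero (k d s : ℕ) (hkd : 0 < d + k) (hs0 : 0 < s)
    (hs : s ≤ tInv k d) :
    ∃ x ∈ QDeg k (k * (2 ^ s - 1) + 2 ^ s * d), x ≠ 0 ∧ kameko k x = 0 := by
  obtain ⟨c, hc, ⟨j, hj⟩, hdeg⟩ := exists_spike k d s hkd hs0 hs
  refine ⟨(hit k).mkQ (monomial c 1), ⟨_, isHomogeneous_monomial _ hdeg, rfl⟩, fun h0 => ?_, ?_⟩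
  · exact spike_notMem_hit k c hc ((Submodule.Quotient.mk_eq_zero _).1 h0)
  · have hphi : phi k (monomial c 1) = 0 := by
      rw [phi_monomial, if_neg]
      intro hodd
      have := hodd j
      rw [hj] at this
      exact absurd this (by decide)
    exact (congrArg (hit k).mkQ hphi).trans (map_zero _)

end HitProblem

theorem mainTheorem1 (k d t : ℕ) (hkd : 0 < d + k) :
    (∀ (s : ℕ) (hts : t ≤ s),
      (HitProblem.glQDeg k (k * (2 ^ s - 1) + 2 ^ s * d)).IsIntertwiningMap
          (HitProblem.glQDeg k (k * (2 ^ t - 1) + 2 ^ t * d)) (HitProblem.kamekoIter k d hts) ∧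
        Function.Bijective (HitProblem.kamekoIter k d hts)) ↔
      HitProblem.tInv k d ≤ (t : ℤ) := by
  constructor
  · intro h
    by_contra! hlt
    have h0 : (HitProblem.tInv k d).toNat = HitProblem.tInv k d := Int.toNat_of_nonneg (by omega)
    -- The largest `s` for which a killed spike was constructed; it exceeds `t`, so at least one
    -- Kameko step is applied in degree `n_s`.
    obtain ⟨s, hs⟩ : ∃ s, s = (HitProblem.tInv k d).toNat := ⟨_, rfl⟩
    have hts : t < s := by omega
    obtain ⟨x, hx, hx0, hkx⟩ :=
      HitProblem.exists_ne_zero_kameko_eq_zero k d s hkd (by omega) (by omega)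
    have hzero : HitProblem.kamekoIter k d hts.le ⟨x, hx⟩ = 0 := by
      apply Subtype.ext
      change (HitProblem.kameko k ^ (s - t)) x = 0
      -- The innermost factor of the iterate already kills `x`.
      rw [show s - t = s - t - 1 + 1 by omega, pow_succ, Module.End.mul_apply, hkx, map_zero]
    have hinj := (h s hts.le).2.1 (hzero.trans (map_zero _).symm)
    exact hx0 (congrArg Subtype.val hinj)
  · intro ht s hts
    obtain ⟨r, rfl⟩ := Nat.exists_eq_add_of_le hts
    have hval : ∀ x, (HitProblem.kamekoIter k d hts x : HitProblem.Q k) =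
        (HitProblem.kameko k ^ r) x := by
      intro x
      change (HitProblem.kameko k ^ (t + r - t)) (x : HitProblem.Q k) = _
      rw [Nat.add_sub_cancel_left]
    refine ⟨⟨fun g x => Subtype.ext ?_⟩, ?_, ?_⟩
    · rw [hval]
      refine (HitProblem.kameko_pow_glQ k r g x).trans ?_
      rw [← hval]
      rfl
    · rw [injective_iff_map_eq_zero]
      intro x hx
      have h0 := congrArg Subtype.val hx
      rw [hval] at h0
      exact Subtype.ext (HitProblem.kameko_pow_injOn k d t r hkd ht x.2 h0)
    · rintro ⟨y, hy⟩
      obtain ⟨x, hx, rfl⟩ := HitProblem.kameko_pow_surjOn k d t r hy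
      exact ⟨⟨x, hx⟩, Subtype.ext (hval _)⟩
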